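/- Let $\mathbb{C}^+=\{z\in\mathbb{C}:\operatorname{Re} z>0\}$ and let $\phi\in H^\infty(\mathbb{C}^+)$, that is, $\phi$ is a bounded analytic function on $\mathbb{C}^+$. Then for almost every $t\in\mathbb{R}$ the nontangential limit of $\phi$ at the boundary point $it$ exists; denote it by $\phi(it)$. The boundary function $t\mapsto\phi(it)$ belongs to $L^\infty(\mathbb{R})$, and \[\limsup_{\theta\to\infty}\,\sup_{y\in\mathbb{R}}\frac{1}{2\theta}\int_{y-\theta}^{y+\theta}\operatorname{Re}\phi(it)\,dt=\limsup_{x\to\infty}\,\sup_{y\in\mathbb{R}}\operatorname{Re}\phi(x+iy),\] \[\liminf_{\theta\to\infty}\,\inf_{y\in\mathbb{R}}\frac{1}{2\theta}\int_{y-\theta}^{y+\theta}\operatorname{Re}\phi(it)\,dt=\liminf_{x\to\infty}\,\inf_{y\in\mathbb{R}}\operatorname{Re}\phi(x+iy).\] Both equations also hold with $\operatorname{Re}$ replaced by $\operatorname{Im}$ on both sides. -/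

import Mathlib

open Filter Topology MeasureTheory

/-- The open right half plane `{z : ℂ | Re z > 0}`. -/
def rightHalfPlane : Set ℂ := {z : ℂ | 0 < z.re}

/-- `φ` is a bounded analytic function on the right half plane. The values of `φ` outside the
half plane play no role. -/
def IsHInfty (φ : ℂ → ℂ) : Prop :=
  DifferentiableOn ℂ φ rightHalfPlane ∧ ∃ C : ℝ, ∀ z ∈ rightHalfPlane, ‖φ z‖ ≤ C

/-- The sector of aperture `α` in the right half plane with vertex at the boundary point `i t`. -/
def stolzSector (α t : ℝ) : Set ℂ := {z : ℂ | 0 < z.re ∧ |z.im - t| ≤ α * z.re}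

/-- `φ` has the nontangential limit `L` at the boundary point `i t`: it tends to `L` inside every
sector with vertex at `i t`. -/
def HasNontangentialLimit (φ : ℂ → ℂ) (t : ℝ) (L : ℂ) : Prop :=
  ∀ α : ℝ, 0 < α → Tendsto φ (𝓝[stolzSector α t] ((t : ℂ) * Complex.I)) (𝓝 L)

open Classical in
/-- The boundary function `t ↦ φ (i t)`: the nontangential limit of `φ` at `i t` where it exists,
and `0` elsewhere. -/
noncomputable def boundaryFunction (φ : ℂ → ℂ) (t : ℝ) : ℂ :=
  if h : ∃ L : ℂ, HasNontangentialLimit φ t L then h.choose else 0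

/-- The average `(1 / 2θ) ∫_{y-θ}^{y+θ} u(t) dt`. -/
noncomputable def intervalMean (u : ℝ → ℝ) (θ y : ℝ) : ℝ :=
  1 / (2 * θ) * ∫ t in (y - θ)..(y + θ), u t

/-! Everything passes through a primitive `F` of `φ`, Lipschitz because `φ` is bounded. On the
imaginary axis `F` is differentiable almost everywhere; at such a point Phragmén-Lindelöf carries
the first-order expansion into the half plane, and Cauchy's estimate turns it into a nontangential
limit of `φ`. The mean of `Re φ` over `[y-θ, y+θ]` is then the real part of the difference quotient
`verticalSlope F θ` at `iy`. Moving this quotient from `iy` to `x+iy` costs at most `K x / θ`, and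
there its real part is a value of `Re φ` on the line `Re z = x`; let `θ → ∞`. Conversely, a bound
for its real part on the axis holds inside (`verticalSlope_re_le`), where it differs from `Re
φ(x+iy)` by at most `2 C θ / x`; let `x → ∞`. The other three equations follow by applying this to
multiples of `φ`. -/

theorem isOpen_rightHalfPlane : IsOpen rightHalfPlane :=
  isOpen_lt continuous_const Complex.continuous_re

theorem convex_rightHalfPlane : Convex ℝ rightHalfPlane :=
  convex_halfSpace_re_gt 0

/-! ### Lipschitz primitives -/

/-- A holomorphic function on the right half plane has a primitive there. -/
theorem exists_primitive {φ : ℂ → ℂ} (hφ : DifferentiableOn ℂ φ rightHalfPlane) :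
    ∃ F : ℂ → ℂ, ∀ z ∈ rightHalfPlane, HasDerivAt F (φ z) z := by
  have hne : ∀ ζ ∈ Metric.ball (0 : ℂ) 1, 1 - ζ ≠ 0 := by
    rintro ζ hζ h
    rw [sub_eq_zero] at h
    simp [← h] at hζ
  have hmaps : ∀ ζ ∈ Metric.ball (0 : ℂ) 1, (1 + ζ) / (1 - ζ) ∈ rightHalfPlane := by
    intro ζ hζ
    have hn : 0 < Complex.normSq (1 - ζ) := Complex.normSq_pos.2 (hne ζ hζ)
    have hlt : ζ.re * ζ.re + ζ.im * ζ.im < 1 := by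
      rw [← Complex.normSq_apply, Complex.normSq_eq_norm_sq]
      have : ‖ζ‖ < 1 := by simpa using hζ
      nlinarith [norm_nonneg ζ]
    change 0 < ((1 + ζ) / (1 - ζ)).re
    rw [Complex.div_re, ← add_div]
    refine div_pos ?_ hn
    simp only [Complex.add_re, Complex.sub_re, Complex.one_re, Complex.add_im, Complex.sub_im,
      Complex.one_im]
    nlinarith
  -- The form `φ dz` pulled back to the disc by the Cayley map; the second factor is the derivative
  -- of that map.
  have hd : DifferentiableOn ℂ (fun ζ => φ ((1 + ζ) / (1 - ζ)) * (2 / (1 - ζ) ^ 2))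
      (Metric.ball 0 1) := by
    refine DifferentiableOn.mul (hφ.comp ?_ hmaps) ?_
    · exact DifferentiableOn.div (by fun_prop) (by fun_prop) hne
    · exact DifferentiableOn.div (by fun_prop) (by fun_prop) fun ζ hζ => pow_ne_zero 2 (hne ζ hζ)
  obtain ⟨Φ, hΦ⟩ := hd.isExactOn_ball
  refine ⟨fun z => Φ ((z - 1) / (z + 1)), fun z hz => ?_⟩
  have hz' : 0 < z.re := hz
  have hz1 : z + 1 ≠ 0 := by
    intro h
    have := congrArg Complex.re h
    simp at this
    linarith
  have hball : (z - 1) / (z + 1) ∈ Metric.ball (0 : ℂ) 1 := by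
    rw [mem_ball_zero_iff, norm_div, div_lt_one (norm_pos_iff.2 hz1)]
    refine lt_of_pow_lt_pow_left₀ 2 (norm_nonneg _) ?_
    rw [← Complex.normSq_eq_norm_sq, ← Complex.normSq_eq_norm_sq, Complex.normSq_apply,
      Complex.normSq_apply]
    simp only [Complex.add_re, Complex.sub_re, Complex.one_re, Complex.add_im, Complex.sub_im,
      Complex.one_im]
    nlinarith
  have hζ : HasDerivAt (fun z : ℂ => (z - 1) / (z + 1)) (2 / (z + 1) ^ 2) z := by
    have := ((hasDerivAt_id z).sub_const 1).div ((hasDerivAt_id z).add_const 1) hz1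
    refine this.congr_deriv ?_
    simp only [id]
    ring
  refine ((hΦ _ hball).comp z hζ).congr_deriv ?_
  have e1 : 1 - (z - 1) / (z + 1) = 2 / (z + 1) := by field_simp; ring
  have e2 : (1 + (z - 1) / (z + 1)) / (1 - (z - 1) / (z + 1)) = z := by
    rw [e1]; field_simp; ring
  beta_reduce
  rw [e2, e1]
  field_simp

/-- A bounded holomorphic function on the right half plane has a primitive which extends to a
Lipschitz function on the whole plane. -/
theorem IsHInfty.exists_lipschitz_primitive {φ : ℂ → ℂ} (hφ : IsHInfty φ) :
    ∃ (K : NNReal) (F : ℂ → ℂ), LipschitzWith K F ∧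
      ∀ z ∈ rightHalfPlane, HasDerivAt F (φ z) z := by
  obtain ⟨hd, C, hC⟩ := hφ
  obtain ⟨F, hF⟩ := exists_primitive hd
  have hlip : LipschitzOnWith C.toNNReal F rightHalfPlane :=
    convex_rightHalfPlane.lipschitzOnWith_of_nnnorm_hasDerivWithin_le
      (fun z hz => (hF z hz).hasDerivWithinAt)
      (fun z hz => by
        rw [← NNReal.coe_le_coe]
        exact (hC z hz).trans (Real.le_coe_toNNReal C))
  obtain ⟨G, hG, hEq⟩ := hlip.extend_finite_dimension
  refine ⟨_, G, hG, fun z hz => (hF z hz).congr_of_eventuallyEq ?_⟩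
  filter_upwards [isOpen_rightHalfPlane.mem_nhds hz] with w hw using (hEq hw).symm

/-! ### Nontangential limits by Phragmén-Lindelöf -/

/-- The Phragmén-Lindelöf principle for bounded functions on the right half plane. -/
theorem norm_le_of_norm_le_on_imaginary_axis {f : ℂ → ℂ} {B M : ℝ}
    (hd : DifferentiableOn ℂ f rightHalfPlane) (hc : ContinuousOn f {z | 0 ≤ z.re})
    (hB : ∀ z ∈ rightHalfPlane, ‖f z‖ ≤ B) (hM : ∀ s : ℝ, ‖f (s * Complex.I)‖ ≤ M)
    {z : ℂ} (hz : z ∈ rightHalfPlane) : ‖f z‖ ≤ M := by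
  refine PhragmenLindelof.right_half_plane_of_bounded_on_real (f := f)
    ⟨hd, ?_⟩ ⟨1, by norm_num, 0, ?_⟩ ?_ hM (le_of_lt hz)
  · rwa [Complex.closure_setOfPred_lt_re]
  · refine Asymptotics.IsBigO.of_bound B ?_
    filter_upwards [mem_inf_of_right (mem_principal_self _)] with w hw
    simpa using hB w hw
  · refine ⟨B, eventually_map.2 ?_⟩
    filter_upwards [eventually_gt_atTop 0] with x hx
    exact hB x (by simpa [rightHalfPlane] using hx)

/-- If `G` is Lipschitz, holomorphic on the right half plane, and `G = o(z)` at the origin along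
the imaginary axis, then `G = o(z)` at the origin on the half plane. -/
theorem isLittleO_of_isLittleO_imaginary_axis {G : ℂ → ℂ} {K : NNReal} (hK : LipschitzWith K G)
    (hd : DifferentiableOn ℂ G rightHalfPlane) (h0 : G 0 = 0)
    (hs : (fun s : ℝ => G (s * Complex.I)) =o[𝓝 0] fun s : ℝ => s) :
    G =o[𝓝[rightHalfPlane] 0] fun z => z := by
  have hGn : ∀ z, ‖G z‖ ≤ K * ‖z‖ := fun z => by
    simpa [h0, dist_eq_norm] using hK.dist_le_mul z 0
  refine Asymptotics.isLittleO_iff.2 fun c hc => ?_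
  obtain ⟨ε, hε⟩ : ∃ ε, ε = c / 8 := ⟨_, rfl⟩
  have hε0 : 0 < ε := by rw [hε]; positivity
  obtain ⟨δ, hδ0, hδ⟩ := Metric.eventually_nhds_iff.1 (Asymptotics.isLittleO_iff.1 hs hε0)
  -- The little-o bound serves for `|s| < δ`; beyond that, linear growth is absorbed by the
  -- quadratic term.
  have haxis : ∀ s : ℝ, ‖G (s * Complex.I)‖ ≤ ε * |s| + K / δ * s ^ 2 := by
    intro s
    rcases lt_or_ge |s| δ with h | h
    · have := hδ (show dist s 0 < δ by simpa using h)
      rw [Real.norm_eq_abs] at this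
      have h2 : 0 ≤ K / δ * s ^ 2 := by positivity
      linarith
    · have h1 := hGn (s * Complex.I)
      have h2 : ‖(s : ℂ) * Complex.I‖ = |s| := by simp
      rw [h2] at h1
      have h3 : (K : ℝ) * |s| ≤ K / δ * s ^ 2 := by
        rw [div_mul_eq_mul_div, le_div_iff₀ hδ0, ← sq_abs s, mul_assoc]
        gcongr
        nlinarith [abs_nonneg s]
      have h4 : 0 ≤ ε * |s| := by positivity
      linarith
  have hsmall : ∀ᶠ z : ℂ in 𝓝[rightHalfPlane] 0, K / δ * ‖z‖ < ε := by
    refine nhdsWithin_le_nhds ?_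
    refine (Continuous.tendsto' (by fun_prop) 0 0 (by simp) :
      Tendsto (fun z : ℂ => K / δ * ‖z‖) (𝓝 0) (𝓝 0)).eventually_lt_const hε0
  filter_upwards [hsmall, self_mem_nhdsWithin] with z hz hzr
  have hz0 : z ≠ 0 := by
    rintro rfl
    exact lt_irrefl (0 : ℝ) hzr
  obtain ⟨r, hr⟩ : ∃ r, r = ‖z‖ := ⟨_, rfl⟩
  have hr0 : 0 < r := hr ▸ norm_pos_iff.2 hz0
  rw [← hr] at hz ⊢
  have hden : ∀ w : ℂ, 0 ≤ w.re → r ^ 2 + ‖w‖ ^ 2 ≤ ‖w + r‖ ^ 2 := by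
    intro w hw
    rw [← Complex.normSq_eq_norm_sq, ← Complex.normSq_eq_norm_sq, Complex.normSq_apply,
      Complex.normSq_apply]
    simp only [Complex.add_re, Complex.add_im, Complex.ofReal_re, Complex.ofReal_im]
    nlinarith
  have hne : ∀ w : ℂ, 0 ≤ w.re → (w + r) ^ 2 ≠ 0 := by
    intro w hw h
    have := hden w hw
    rw [← norm_pow (w + r), h, norm_zero] at this
    nlinarith [sq_nonneg ‖w‖]
  -- Since `|w + r|² ≥ r² + |w|²` on the closed half plane, the divisor dominates both axis terms;
  -- as `r = |z|`, undoing the division at `z` costs at most `4 r²`.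
  have key : ‖G z / (z + r) ^ 2‖ ≤ ε / r + K / δ := by
    refine norm_le_of_norm_le_on_imaginary_axis (f := fun w => G w / (w + r) ^ 2) (B := K / r)
      ?_ ?_ ?_ ?_ hzr
    · exact hd.div (by fun_prop) fun w hw => hne w (le_of_lt hw)
    · exact hK.continuous.continuousOn.div (by fun_prop) fun w hw => hne w hw
    · intro w hw
      have h1 := hden w (le_of_lt hw)
      rw [norm_div, norm_pow, div_le_div_iff₀ (by nlinarith [sq_nonneg ‖w‖]) hr0]
      have h2 : ‖w‖ * r ≤ ‖w + r‖ ^ 2 := by nlinarith [sq_nonneg (‖w‖ - r), norm_nonneg w]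
      calc ‖G w‖ * r ≤ K * ‖w‖ * r := by gcongr; exact hGn w
        _ = K * (‖w‖ * r) := by ring
        _ ≤ _ := by gcongr
    · intro s
      have h1 := hden (s * Complex.I) (by simp)
      have h2 : ‖(s : ℂ) * Complex.I‖ = |s| := by simp
      rw [h2] at h1
      rw [norm_div, norm_pow, div_le_iff₀ (by nlinarith [sq_nonneg |s|])]
      refine (haxis s).trans ?_
      have h3 : ε * |s| ≤ ε / r * ‖(s : ℂ) * Complex.I + r‖ ^ 2 := by
        rw [div_mul_eq_mul_div, le_div_iff₀ hr0, mul_assoc]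
        gcongr
        nlinarith [sq_nonneg (|s| - r), abs_nonneg s]
      have h4 : K / δ * s ^ 2 ≤ K / δ * ‖(s : ℂ) * Complex.I + r‖ ^ 2 := by
        refine mul_le_mul_of_nonneg_left ?_ (by positivity)
        nlinarith [sq_abs s]
      linarith
  have hnum : ‖z + r‖ ^ 2 ≤ 4 * r ^ 2 := by
    have : ‖z + r‖ ≤ r + r := (norm_add_le _ _).trans (by simp [← hr, abs_of_pos hr0])
    nlinarith [norm_nonneg (z + r)]
  rw [norm_div, norm_pow, div_le_iff₀ (by nlinarith [hden z (le_of_lt hzr), sq_nonneg ‖z‖])] at key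
  calc ‖G z‖ ≤ (ε / r + K / δ) * ‖z + r‖ ^ 2 := key
    _ ≤ (ε / r + K / δ) * (4 * r ^ 2) := by gcongr
    _ = 4 * r * (ε + K / δ * r) := by field_simp
    _ ≤ 4 * r * (ε + ε) := by gcongr
    _ = c * r := by rw [hε]; ring

/-- Let `F` be a Lipschitz primitive of `φ`. At a point where the boundary function of `F` is
differentiable along the imaginary axis, `φ` has a nontangential limit. -/
theorem hasNontangentialLimit_of_hasDerivAt {φ F : ℂ → ℂ} {K : NNReal} (hK : LipschitzWith K F)
    (hF : ∀ z ∈ rightHalfPlane, HasDerivAt F (φ z) z) {t : ℝ} {L : ℂ}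
    (h : HasDerivAt (fun s : ℝ => F (s * Complex.I)) (L * Complex.I) t) :
    HasNontangentialLimit φ t L := by
  -- `G` is the first-order remainder of `F` at `it`, recentred at the origin; its derivative is `φ
  -- - L`.
  obtain ⟨G, hG⟩ : ∃ G : ℂ → ℂ, ∀ w, G w = F (w + t * Complex.I) - F (t * Complex.I) - L * w :=
    ⟨_, fun _ => rfl⟩
  have hGK : LipschitzWith (K + ‖L‖₊) G := by
    refine LipschitzWith.of_dist_le_mul fun a b => ?_
    have h1 := hK.dist_le_mul (a + t * Complex.I) (b + t * Complex.I)
    rw [dist_eq_norm, dist_eq_norm, add_sub_add_right_eq_sub] at h1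
    rw [dist_eq_norm, dist_eq_norm, hG, hG]
    calc ‖_‖ = ‖(F (a + t * Complex.I) - F (b + t * Complex.I)) - L * (a - b)‖ := by
          congr 1; ring
      _ ≤ K * ‖a - b‖ + ‖L‖ * ‖a - b‖ := (norm_sub_le _ _).trans (by rw [norm_mul]; gcongr)
      _ = _ := by push_cast; ring
  have hGd : ∀ w ∈ rightHalfPlane, HasDerivAt G (φ (w + t * Complex.I) - L) w := by
    intro w hw
    have hw' : w + t * Complex.I ∈ rightHalfPlane := by
      change 0 < (w + t * Complex.I).re
      simpa using (show 0 < w.re from hw)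
    have h1 := (((hF _ hw').comp_add_const w _).sub_const (F (t * Complex.I))).sub
      ((hasDerivAt_id w).const_mul L)
    rw [mul_one] at h1
    exact h1.congr_of_eventuallyEq (Eventually.of_forall hG)
  have hlo : G =o[𝓝[rightHalfPlane] 0] fun z => z := by
    refine isLittleO_of_isLittleO_imaginary_axis hGK
      (fun w hw => (hGd w hw).differentiableAt.differentiableWithinAt) (by simp [hG]) ?_
    refine (hasDerivAt_iff_isLittleO_nhds_zero.1 h).congr_left fun s => ?_
    rw [hG, Complex.real_smul]
    push_cast
    rw [add_mul, add_comm ((s : ℂ) * Complex.I)]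
    ring
  intro α hα
  rw [Metric.tendsto_nhdsWithin_nhds]
  intro ε hε
  obtain ⟨c, hc⟩ : ∃ c, c = ε / (2 * (2 * (1 + α) + 1)) := ⟨_, rfl⟩
  have hc0 : 0 < c := by rw [hc]; positivity
  have hev := Asymptotics.isLittleO_iff.1 hlo hc0
  rw [eventually_nhdsWithin_iff, Metric.eventually_nhds_iff] at hev
  obtain ⟨δ, hδ0, hδ⟩ := hev
  refine ⟨δ / 2, by positivity, fun z hz hzd => ?_⟩
  obtain ⟨w, hw⟩ : ∃ w, w = z - t * Complex.I := ⟨_, rfl⟩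
  have hzw : z = w + t * Complex.I := by rw [hw]; ring
  have hre : w.re = z.re := by simp [hw]
  have him : w.im = z.im - t := by simp [hw]
  have hx : 0 < w.re := hre ▸ hz.1
  have hwn : ‖w‖ ≤ (1 + α) * w.re := by
    refine (Complex.norm_le_abs_re_add_abs_im w).trans ?_
    have := hz.2
    rw [← him, ← hre] at this
    rw [abs_of_pos hx]
    linarith
  have hwδ : ‖w‖ < δ / 2 := by rwa [dist_eq_norm, ← hw] at hzd
  have hwre : w.re ≤ ‖w‖ := Complex.re_le_norm w
  have hsub : ∀ v ∈ Metric.closedBall w (w.re / 2), v ∈ rightHalfPlane := by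
    intro v hv
    rw [mem_closedBall_iff_norm] at hv
    have h1 := (Complex.abs_re_le_norm (v - w)).trans hv
    rw [Complex.sub_re] at h1
    have h2 := neg_le_of_abs_le h1
    change 0 < v.re
    linarith
  -- In the sector `|w|` is comparable to `Re w`, hence to the radius, so `G = o(w)` makes `G'`
  -- small; `c` was chosen to give `ε / 2`.
  have hder := Complex.norm_deriv_le_of_forall_mem_sphere_norm_le (f := G) (c := w)
    (R := w.re / 2) (C := c * ((1 + α) * w.re + w.re / 2)) (by positivity)
    (DifferentiableOn.diffContOnCl fun v hv =>
      (hGd v (hsub v (Metric.closure_ball_subset_closedBall hv))).differentiableAt.differentiableWithinAt)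
    (fun v hv => by
      have hvr := hsub v (Metric.sphere_subset_closedBall hv)
      have hv' : ‖v - w‖ = w.re / 2 := by simpa [dist_eq_norm] using hv
      have hvn : ‖v‖ ≤ ‖w‖ + w.re / 2 := by
        have := norm_add_le w (v - w)
        rw [add_sub_cancel] at this
        linarith
      have h1 := hδ (show dist v 0 < δ by rw [dist_zero_right]; linarith) hvr
      refine h1.trans ?_
      gcongr
      linarith)
  rw [(hGd w hx).deriv, ← hzw] at hder
  rw [dist_eq_norm]
  refine hder.trans_lt ?_
  have : c * ((1 + α) * w.re + w.re / 2) / (w.re / 2) = ε / 2 := by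
    rw [hc]; field_simp
  linarith

/-- A bounded holomorphic function on the right half plane has nontangential limits at almost every
boundary point. -/
theorem IsHInfty.ae_exists_hasNontangentialLimit {φ : ℂ → ℂ} (hφ : IsHInfty φ) :
    ∀ᵐ t : ℝ, ∃ L : ℂ, HasNontangentialLimit φ t L := by
  obtain ⟨K, F, hK, hF⟩ := hφ.exists_lipschitz_primitive
  have hlip : LipschitzWith K (fun s : ℝ => F (s * Complex.I)) := by
    refine LipschitzWith.of_dist_le_mul fun a b => ?_
    have h1 := hK.dist_le_mul (a * Complex.I) (b * Complex.I)
    rwa [dist_eq_norm (_ * _), ← sub_mul, norm_mul, Complex.norm_I, mul_one, ← Complex.ofReal_sub,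
      Complex.norm_real, ← dist_eq_norm] at h1
  filter_upwards [hlip.ae_differentiableAt_real] with t ht
  refine ⟨deriv (fun s : ℝ => F (s * Complex.I)) t / Complex.I,
    hasNontangentialLimit_of_hasDerivAt hK hF ?_⟩
  rw [div_mul_cancel₀ _ Complex.I_ne_zero]
  exact ht.hasDerivAt

theorem IsHInfty.ae_hasNontangentialLimit_boundaryFunction {φ : ℂ → ℂ} (hφ : IsHInfty φ) :
    ∀ᵐ t : ℝ, HasNontangentialLimit φ t (boundaryFunction φ t) := by
  filter_upwards [hφ.ae_exists_hasNontangentialLimit] with t ht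
  rw [boundaryFunction, dif_pos ht]
  exact ht.choose_spec

theorem HasNontangentialLimit.tendsto_radial {φ : ℂ → ℂ} {t : ℝ} {L : ℂ}
    (h : HasNontangentialLimit φ t L) :
    Tendsto (fun x : ℝ => φ (x + t * Complex.I)) (𝓝[>] 0) (𝓝 L) := by
  refine (h 1 one_pos).comp (tendsto_nhdsWithin_iff.2 ⟨?_, ?_⟩)
  · refine (Continuous.tendsto' ?_ 0 _ (by simp)).mono_left nhdsWithin_le_nhds
    fun_prop
  · filter_upwards [self_mem_nhdsWithin] with x hx
    have hx' : 0 < x := hx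
    constructor
    · simpa using hx'
    · simpa using hx'.le

theorem HasNontangentialLimit.const_mul {φ : ℂ → ℂ} {t : ℝ} {L : ℂ}
    (h : HasNontangentialLimit φ t L) (c : ℂ) :
    HasNontangentialLimit (fun z => c * φ z) t (c * L) :=
  fun α hα => (h α hα).const_mul c

theorem IsHInfty.const_mul {φ : ℂ → ℂ} (hφ : IsHInfty φ) (c : ℂ) :
    IsHInfty fun z => c * φ z := by
  obtain ⟨hd, C, hC⟩ := hφ
  refine ⟨hd.const_mul c, ‖c‖ * C, fun z hz => ?_⟩
  rw [norm_mul]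
  gcongr
  exact hC z hz

theorem mem_rightHalfPlane {x : ℝ} (hx : 0 < x) (y : ℝ) :
    (x : ℂ) + y * Complex.I ∈ rightHalfPlane := by
  change 0 < ((x : ℂ) + y * Complex.I).re
  simpa using hx

theorem continuous_vertical {φ : ℂ → ℂ} (hφ : DifferentiableOn ℂ φ rightHalfPlane) {x : ℝ}
    (hx : 0 < x) : Continuous fun s : ℝ => φ (x + s * Complex.I) :=
  hφ.continuousOn.comp_continuous (by fun_prop) fun s => mem_rightHalfPlane hx s

/-! ### The boundary function and its integral -/

section Boundary

variable {φ : ℂ → ℂ} {b : ℝ → ℂ}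

/-- An almost everywhere limit of continuous restrictions to vertical lines. Leaving `b` arbitrary
lets the results apply to multiples of `φ` without identifying their `boundaryFunction`. -/
theorem IsHInfty.aestronglyMeasurable_of_boundary (hφ : IsHInfty φ)
    (hb : ∀ᵐ t : ℝ, HasNontangentialLimit φ t (b t)) : AEStronglyMeasurable b volume := by
  obtain ⟨u, -, hu0, hu⟩ := exists_seq_strictAnti_tendsto (0 : ℝ)
  refine aestronglyMeasurable_of_tendsto_ae atTop
    (f := fun n (t : ℝ) => φ (u n + t * Complex.I))
    (fun n => (continuous_vertical hφ.1 (hu0 n)).aestronglyMeasurable) ?_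
  filter_upwards [hb] with t ht
  exact ht.tendsto_radial.comp (tendsto_nhdsWithin_iff.2 ⟨hu, Eventually.of_forall hu0⟩)

theorem ae_norm_le_of_boundary {C : ℝ} (hC : ∀ z ∈ rightHalfPlane, ‖φ z‖ ≤ C)
    (hb : ∀ᵐ t : ℝ, HasNontangentialLimit φ t (b t)) : ∀ᵐ t : ℝ, ‖b t‖ ≤ C := by
  filter_upwards [hb] with t ht
  refine le_of_tendsto ht.tendsto_radial.norm ?_
  filter_upwards [self_mem_nhdsWithin] with x hx using hC _ (mem_rightHalfPlane hx t)

theorem IsHInfty.memLp_top_of_boundary (hφ : IsHInfty φ)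
    (hb : ∀ᵐ t : ℝ, HasNontangentialLimit φ t (b t)) : MemLp b ⊤ volume := by
  obtain ⟨C, hC⟩ := hφ.2
  exact memLp_top_of_bound (hφ.aestronglyMeasurable_of_boundary hb) C
    (ae_norm_le_of_boundary hC hb)

theorem IsHInfty.intervalIntegrable_of_boundary (hφ : IsHInfty φ)
    (hb : ∀ᵐ t : ℝ, HasNontangentialLimit φ t (b t)) (a c : ℝ) :
    IntervalIntegrable b volume a c := by
  obtain ⟨C, hC⟩ := hφ.2
  rw [intervalIntegrable_iff]
  exact Measure.integrableOn_of_bounded (M := C) (by simp)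
    (hφ.aestronglyMeasurable_of_boundary hb)
    (ae_restrict_of_ae (ae_norm_le_of_boundary hC hb))

/-- The integral of the boundary function is given by the boundary values of the primitive. -/
theorem IsHInfty.integral_boundary (hφ : IsHInfty φ)
    (hb : ∀ᵐ t : ℝ, HasNontangentialLimit φ t (b t)) {F : ℂ → ℂ} (hFc : Continuous F)
    (hF : ∀ z ∈ rightHalfPlane, HasDerivAt F (φ z) z) (a c : ℝ) :
    ∫ t in a..c, b t = (F (c * Complex.I) - F (a * Complex.I)) / Complex.I := by
  obtain ⟨C, hC⟩ := hφ.2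
  have h1 : Tendsto (fun x : ℝ => ∫ t in a..c, φ (x + t * Complex.I)) (𝓝[>] 0)
      (𝓝 (∫ t in a..c, b t)) := by
    refine intervalIntegral.tendsto_integral_filter_of_dominated_convergence (fun _ => C)
      ?_ ?_ intervalIntegrable_const ?_
    · filter_upwards [self_mem_nhdsWithin] with x hx
      exact (continuous_vertical hφ.1 hx).aestronglyMeasurable
    · filter_upwards [self_mem_nhdsWithin] with x hx
      exact Eventually.of_forall fun t _ => hC _ (mem_rightHalfPlane hx t)
    · filter_upwards [hb] with t ht _ using ht.tendsto_radial
  have h2 : Tendsto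
      (fun x : ℝ => (F (x + c * Complex.I) - F (x + a * Complex.I)) / Complex.I) (𝓝[>] 0)
      (𝓝 ((F (c * Complex.I) - F (a * Complex.I)) / Complex.I)) := by
    refine (Continuous.tendsto' ?_ 0 _ (by simp)).mono_left nhdsWithin_le_nhds
    fun_prop
  refine tendsto_nhds_unique h1 (h2.congr' ?_)
  filter_upwards [self_mem_nhdsWithin] with x hx
  rw [sub_div]
  refine (intervalIntegral.integral_eq_sub_of_hasDerivAt
    (f := fun s : ℝ => F (x + s * Complex.I) / Complex.I) (fun s _ => ?_)
    ((continuous_vertical hφ.1 hx).intervalIntegrable _ _)).symm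
  have h3 : HasDerivAt (fun s : ℝ => (x : ℂ) + s * Complex.I) (1 * Complex.I) s :=
    (Complex.ofRealCLM.hasDerivAt.mul_const Complex.I).const_add (x : ℂ)
  have h4 := ((hF _ (mem_rightHalfPlane hx s)).comp s h3).div_const Complex.I
  rwa [one_mul, mul_div_cancel_right₀ _ Complex.I_ne_zero] at h4

end Boundary

/-! ### Vertical difference quotients -/

/-- The symmetric difference quotient of `F` at `z` in the vertical direction, of step `θ`. -/
noncomputable def verticalSlope (F : ℂ → ℂ) (θ : ℝ) (z : ℂ) : ℂ :=
  (F (z + θ * Complex.I) - F (z - θ * Complex.I)) / (2 * θ * Complex.I)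

theorem norm_two_mul_mul_I {θ : ℝ} (hθ : 0 < θ) : ‖(2 * θ * Complex.I : ℂ)‖ = 2 * θ := by
  simp [abs_of_pos hθ]

section Slope

variable {φ F : ℂ → ℂ} {K : NNReal} {θ x : ℝ}

theorem norm_verticalSlope_le (hK : LipschitzWith K F) (hθ : 0 < θ) (z : ℂ) :
    ‖verticalSlope F θ z‖ ≤ K := by
  rw [verticalSlope, norm_div, norm_two_mul_mul_I hθ, div_le_iff₀ (by positivity),
    ← norm_two_mul_mul_I hθ, ← dist_eq_norm]
  refine (hK.dist_le_mul _ _).trans_eq ?_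
  rw [dist_eq_norm]
  congr 2
  ring

theorem norm_verticalSlope_sub_le (hK : LipschitzWith K F) (hθ : 0 < θ) (z w : ℂ) :
    ‖verticalSlope F θ z - verticalSlope F θ w‖ ≤ K * ‖z - w‖ / θ := by
  have h1 := hK.dist_le_mul (z + θ * Complex.I) (w + θ * Complex.I)
  have h2 := hK.dist_le_mul (z - θ * Complex.I) (w - θ * Complex.I)
  rw [dist_eq_norm, dist_eq_norm, add_sub_add_right_eq_sub] at h1
  rw [dist_eq_norm, dist_eq_norm, sub_sub_sub_cancel_right] at h2
  rw [verticalSlope, verticalSlope, ← sub_div, norm_div, norm_two_mul_mul_I hθ,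
    div_le_div_iff₀ (by positivity) hθ, sub_sub_sub_comm]
  have h3 := (norm_sub_le (F (z + θ * Complex.I) - F (w + θ * Complex.I))
    (F (z - θ * Complex.I) - F (w - θ * Complex.I)))
  calc _ ≤ (K * ‖z - w‖ + K * ‖z - w‖) * θ := by gcongr; linarith
    _ = _ := by ring

/-- The mean value theorem for the real part of the vertical difference quotient. -/
theorem exists_verticalSlope_re_eq (hF : ∀ z ∈ rightHalfPlane, HasDerivAt F (φ z) z)
    (hθ : 0 < θ) (hx : 0 < x) (y : ℝ) :
    ∃ ξ ∈ Set.Ioo (y - θ) (y + θ),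
      (verticalSlope F θ (x + y * Complex.I)).re = (φ (x + ξ * Complex.I)).re := by
  have hd : ∀ s : ℝ, HasDerivAt (fun s : ℝ => (F (x + s * Complex.I) / Complex.I).re)
      (φ (x + s * Complex.I)).re s := by
    intro s
    have h3 : HasDerivAt (fun s : ℝ => (x : ℂ) + s * Complex.I) (1 * Complex.I) s :=
      (Complex.ofRealCLM.hasDerivAt.mul_const Complex.I).const_add (x : ℂ)
    have h4 := ((hF _ (mem_rightHalfPlane hx s)).comp s h3).div_const Complex.I
    rw [one_mul, mul_div_cancel_right₀ _ Complex.I_ne_zero] at h4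
    exact Complex.reCLM.hasFDerivAt.comp_hasDerivAt s h4
  obtain ⟨ξ, hξ, h⟩ := exists_hasDerivAt_eq_slope _ _ (show y - θ < y + θ by linarith)
    (fun s _ => (hd s).continuousAt.continuousWithinAt) (fun s _ => hd s)
  refine ⟨ξ, hξ, ?_⟩
  rw [h, ← Complex.sub_re, ← sub_div, show y + θ - (y - θ) = 2 * θ by ring,
    ← Complex.div_ofReal_re, verticalSlope, div_div]
  push_cast
  congr 2
  · congr 2 <;> ring
  · ring

/-- A bound for the real part of the vertical difference quotient on the imaginary axis holds on
the right half plane. -/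
theorem verticalSlope_re_le (hK : LipschitzWith K F)
    (hF : ∀ z ∈ rightHalfPlane, HasDerivAt F (φ z) z) (hθ : 0 < θ) {M : ℝ}
    (hM : ∀ y : ℝ, (verticalSlope F θ (y * Complex.I)).re ≤ M) {z : ℂ} (hz : z ∈ rightHalfPlane) :
    (verticalSlope F θ z).re ≤ M := by
  have hshift : ∀ (s : ℝ) (w : ℂ), w ∈ rightHalfPlane → w + s * Complex.I ∈ rightHalfPlane := by
    intro s w hw
    change 0 < (w + s * Complex.I).re
    simpa using (show 0 < w.re from hw)
  have hd : ∀ (s : ℝ), DifferentiableOn ℂ (fun w => F (w + s * Complex.I)) rightHalfPlane :=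
    fun s w hw => ((hF _ (hshift s w hw)).comp_add_const w _).differentiableAt.differentiableWithinAt
  have hdiff : DifferentiableOn ℂ (fun w => F (w - θ * Complex.I)) rightHalfPlane := by
    have := hd (-θ)
    push_cast at this
    simpa only [neg_mul, ← sub_eq_add_neg] using this
  have hFc := hK.continuous
  -- Exponentiating turns a one-sided bound on the real part into a bound on the modulus.
  have key : ‖Complex.exp (verticalSlope F θ z)‖ ≤ Real.exp M := by
    refine norm_le_of_norm_le_on_imaginary_axis (f := fun w => Complex.exp (verticalSlope F θ w))
      (B := Real.exp K) ?_ ?_ ?_ ?_ hz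
    · exact (((hd θ).sub hdiff).div_const _).cexp
    · refine Continuous.continuousOn ?_
      unfold verticalSlope
      fun_prop
    · intro w _
      rw [Complex.norm_exp]
      exact Real.exp_le_exp.2 ((Complex.re_le_norm _).trans (norm_verticalSlope_le hK hθ w))
    · intro s
      rw [Complex.norm_exp]
      exact Real.exp_le_exp.2 (hM s)
  rwa [Complex.norm_exp, Real.exp_le_exp] at key

end Slope

/-! ### Comparison of the means with the interior values -/

/-- The oscillation of a bounded holomorphic function along vertical lines. -/
theorem norm_sub_le_of_vertical {φ : ℂ → ℂ} (hd : DifferentiableOn ℂ φ rightHalfPlane) {C : ℝ}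
    (hC : ∀ z ∈ rightHalfPlane, ‖φ z‖ ≤ C) {x : ℝ} (hx : 0 < x) (s y : ℝ) :
    ‖φ (x + s * Complex.I) - φ (x + y * Complex.I)‖ ≤ 2 * C / x * |s - y| := by
  have hat : ∀ z ∈ rightHalfPlane, HasDerivAt φ (deriv φ z) z := fun z hz =>
    (hd.differentiableAt (isOpen_rightHalfPlane.mem_nhds hz)).hasDerivAt
  have hder : ∀ s : ℝ, ‖deriv φ (x + s * Complex.I)‖ ≤ 2 * C / x := by
    intro s
    have hsub : ∀ v ∈ Metric.closedBall ((x : ℂ) + s * Complex.I) (x / 2), v ∈ rightHalfPlane := by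
      intro v hv
      rw [mem_closedBall_iff_norm] at hv
      have h1 := (Complex.abs_re_le_norm _).trans hv
      have h2 := neg_le_of_abs_le h1
      simp at h2
      change 0 < v.re
      linarith
    have := Complex.norm_deriv_le_of_forall_mem_sphere_norm_le (f := φ)
      (c := (x : ℂ) + s * Complex.I) (R := x / 2) (C := C) (by positivity)
      (DifferentiableOn.diffContOnCl fun v hv => (hat v
        (hsub v (Metric.closure_ball_subset_closedBall hv))).differentiableAt.differentiableWithinAt)
      (fun v hv => hC v (hsub v (Metric.sphere_subset_closedBall hv)))
    rwa [show C / (x / 2) = 2 * C / x by field_simp] at this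
  refine Convex.norm_image_sub_le_of_norm_hasDerivWithin_le
    (f := fun s : ℝ => φ (x + s * Complex.I))
    (f' := fun s : ℝ => deriv φ (x + s * Complex.I) * (1 * Complex.I)) (s := Set.univ)
    (fun r _ => ?_) (fun r _ => ?_) convex_univ (Set.mem_univ y) (Set.mem_univ s)
  · have h3 : HasDerivAt (fun s : ℝ => (x : ℂ) + s * Complex.I) (1 * Complex.I) r :=
      (Complex.ofRealCLM.hasDerivAt.mul_const Complex.I).const_add (x : ℂ)
    exact ((hat _ (mem_rightHalfPlane hx r)).comp r h3).hasDerivWithinAt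
  · simpa using hder r

theorem IsHInfty.intervalMean_re_eq {φ F : ℂ → ℂ} {b : ℝ → ℂ} (hφ : IsHInfty φ)
    (hb : ∀ᵐ t : ℝ, HasNontangentialLimit φ t (b t)) (hFc : Continuous F)
    (hF : ∀ z ∈ rightHalfPlane, HasDerivAt F (φ z) z) (θ y : ℝ) :
    intervalMean (fun t => (b t).re) θ y = (verticalSlope F θ (y * Complex.I)).re := by
  have h1 := Complex.reCLM.intervalIntegral_comp_comm
    (hφ.intervalIntegrable_of_boundary hb (y - θ) (y + θ))
  simp only [Complex.reCLM_apply] at h1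
  rw [intervalMean, h1, hφ.integral_boundary hb hFc hF, verticalSlope, mul_comm,
    mul_one_div, ← Complex.div_ofReal_re, div_div]
  push_cast
  congr 2
  · congr 2 <;> ring
  · ring

/-- For fixed `x` the error `c * x / θ` vanishes as `θ → ∞`, so the left side is at most every late
supremum of `v`, hence at most their liminf. The hypothesis is symmetric in form, so one lemma
serves both inequalities. -/
theorem limsup_iSup_le_limsup_iSup {u v : ℝ → ℝ → ℝ} {B c : ℝ} (hv : ∀ x > 0, ∀ y, v x y ≤ B)
    (h : ∀ θ > 0, ∀ x > 0, ∀ M, (∀ y, v x y ≤ M) → ∀ y, u θ y ≤ M + c * x / θ) :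
    limsup (fun θ : ℝ => ⨆ y : ℝ, (u θ y : EReal)) atTop ≤
      limsup (fun x : ℝ => ⨆ y : ℝ, (v x y : EReal)) atTop := by
  refine le_trans (le_liminf_of_le (by isBoundedDefault) ?_) (liminf_le_limsup)
  filter_upwards [eventually_gt_atTop 0] with x hx
  obtain ⟨M, hM⟩ : ∃ M : ℝ, ⨆ y : ℝ, (v x y : EReal) = M := by
    refine ⟨_, (EReal.coe_toReal ?_ ?_).symm⟩
    · exact ne_top_of_le_ne_top (EReal.coe_ne_top B)
        (iSup_le fun y => EReal.coe_le_coe_iff.2 (hv x hx y))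
    · exact ne_bot_of_le_ne_bot (EReal.coe_ne_bot (v x 0)) (le_iSup (fun y => (v x y : EReal)) 0)
  rw [hM]
  have hvM : ∀ y, v x y ≤ M := fun y =>
    EReal.coe_le_coe_iff.1 (hM ▸ le_iSup (fun y => (v x y : EReal)) y)
  have hlim : Tendsto (fun θ : ℝ => ((M + c * x / θ : ℝ) : EReal)) atTop (𝓝 M) := by
    refine (continuous_coe_real_ereal.tendsto M).comp ?_
    simpa using (tendsto_const_nhds (x := M)).add
      (tendsto_const_nhds (x := c * x) |>.div_atTop tendsto_id)
  rw [← hlim.limsup_eq]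
  refine limsup_le_limsup ?_
  filter_upwards [eventually_gt_atTop 0] with θ hθ
  exact iSup_le fun y => EReal.coe_le_coe_iff.2 (h θ hθ x hx M hvM y)

/-- The limiting suprema of the boundary means and of the interior values of the real part agree. -/
theorem IsHInfty.limsup_intervalMean_re {φ : ℂ → ℂ} {b : ℝ → ℂ} (hφ : IsHInfty φ)
    (hb : ∀ᵐ t : ℝ, HasNontangentialLimit φ t (b t)) :
    limsup (fun θ : ℝ => ⨆ y : ℝ, ((intervalMean (fun t => (b t).re) θ y : ℝ) : EReal)) atTop
      = limsup (fun x : ℝ => ⨆ y : ℝ, (((φ (x + y * Complex.I)).re : ℝ) : EReal)) atTop := by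
  obtain ⟨K, F, hK, hF⟩ := hφ.exists_lipschitz_primitive
  have hmean := hφ.intervalMean_re_eq hb hK.continuous hF
  obtain ⟨hd, C, hC⟩ := hφ
  simp only [hmean]
  apply le_antisymm
  · refine limsup_iSup_le_limsup_iSup (B := C) (c := K)
      (fun x hx y => (Complex.re_le_norm _).trans (hC _ (mem_rightHalfPlane hx y)))
      fun θ hθ x hx M hM y => ?_
    obtain ⟨ξ, -, hξ⟩ := exists_verticalSlope_re_eq hF hθ hx y
    have h1 := norm_verticalSlope_sub_le hK hθ (y * Complex.I) (x + y * Complex.I)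
    rw [sub_add_cancel_right, norm_neg, Complex.norm_real, Real.norm_of_nonneg hx.le] at h1
    have h2 := (Complex.re_le_norm _).trans h1
    rw [Complex.sub_re] at h2
    linarith [hM ξ]
  -- The roles are exchanged: `x` now tends to infinity with `θ` fixed.
  · refine limsup_iSup_le_limsup_iSup (B := K) (c := 2 * C)
      (fun θ hθ y => (Complex.re_le_norm _).trans (norm_verticalSlope_le hK hθ _))
      fun x hx θ hθ M hM y => ?_
    obtain ⟨ξ, hξmem, hξ⟩ := exists_verticalSlope_re_eq hF hθ hx y
    have h1 := norm_sub_le_of_vertical hd hC hx y ξ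
    have h2 := verticalSlope_re_le hK hF hθ hM (mem_rightHalfPlane hx y)
    have h3 := (Complex.re_le_norm _).trans h1
    have hC0 : 0 ≤ C := (norm_nonneg _).trans (hC _ (mem_rightHalfPlane hx y))
    have h4 : 2 * C / x * |y - ξ| ≤ 2 * C * θ / x := by
      rw [div_mul_eq_mul_div]
      gcongr
      rw [abs_le]
      constructor <;> linarith [hξmem.1, hξmem.2]
    rw [Complex.sub_re] at h3
    linarith

theorem EReal.liminf_iInf_eq_neg_limsup_iSup_neg (u : ℝ → ℝ → ℝ) :
    liminf (fun x : ℝ => ⨅ y : ℝ, (u x y : EReal)) atTop =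
      -limsup (fun x : ℝ => ⨆ y : ℝ, ((-u x y : ℝ) : EReal)) atTop := by
  rw [← EReal.liminf_neg]
  congr 1
  funext x
  rw [Pi.neg_apply, eq_comm, neg_eq_iff_eq_neg]
  exact (EReal.negOrderIso.map_iInf fun y => (u x y : EReal)).symm

/-- The limiting infima of the boundary means and of the interior values of the real part agree. -/
theorem IsHInfty.liminf_intervalMean_re {φ : ℂ → ℂ} {b : ℝ → ℂ} (hφ : IsHInfty φ)
    (hb : ∀ᵐ t : ℝ, HasNontangentialLimit φ t (b t)) :
    liminf (fun θ : ℝ => ⨅ y : ℝ, ((intervalMean (fun t => (b t).re) θ y : ℝ) : EReal)) atTop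
      = liminf (fun x : ℝ => ⨅ y : ℝ, (((φ (x + y * Complex.I)).re : ℝ) : EReal)) atTop := by
  have h := (hφ.const_mul (-1)).limsup_intervalMean_re (b := fun t => -1 * b t)
    (by filter_upwards [hb] with t ht using ht.const_mul (-1))
  rw [EReal.liminf_iInf_eq_neg_limsup_iSup_neg, EReal.liminf_iInf_eq_neg_limsup_iSup_neg]
  congr 1
  simpa [intervalMean] using h

/-- The upper and lower limits, suprema and infima are taken in `EReal`, where they always exist.
The first two conjuncts say that the boundary function is a genuine nontangential limit almost
everywhere and is an element of `L^∞(ℝ)`. -/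
theorem theorem4p1 (φ : ℂ → ℂ) (hφ : IsHInfty φ) :
    (∀ᵐ t : ℝ, HasNontangentialLimit φ t (boundaryFunction φ t)) ∧
    MemLp (boundaryFunction φ) ⊤ (volume : Measure ℝ) ∧
    limsup (fun θ : ℝ => ⨆ y : ℝ,
        ((intervalMean (fun t => (boundaryFunction φ t).re) θ y : ℝ) : EReal)) atTop
      = limsup (fun x : ℝ => ⨆ y : ℝ, (((φ (x + y * Complex.I)).re : ℝ) : EReal)) atTop ∧
    liminf (fun θ : ℝ => ⨅ y : ℝ,
        ((intervalMean (fun t => (boundaryFunction φ t).re) θ y : ℝ) : EReal)) atTop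
      = liminf (fun x : ℝ => ⨅ y : ℝ, (((φ (x + y * Complex.I)).re : ℝ) : EReal)) atTop ∧
    limsup (fun θ : ℝ => ⨆ y : ℝ,
        ((intervalMean (fun t => (boundaryFunction φ t).im) θ y : ℝ) : EReal)) atTop
      = limsup (fun x : ℝ => ⨆ y : ℝ, (((φ (x + y * Complex.I)).im : ℝ) : EReal)) atTop ∧
    liminf (fun θ : ℝ => ⨅ y : ℝ,
        ((intervalMean (fun t => (boundaryFunction φ t).im) θ y : ℝ) : EReal)) atTop
      = liminf (fun x : ℝ => ⨅ y : ℝ, (((φ (x + y * Complex.I)).im : ℝ) : EReal)) atTop := by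
  have hb := hφ.ae_hasNontangentialLimit_boundaryFunction
  -- `Re (-i w) = Im w`.
  have hφ' := hφ.const_mul (-Complex.I)
  have hb' : ∀ᵐ t : ℝ, HasNontangentialLimit (fun z => -Complex.I * φ z) t
      (-Complex.I * boundaryFunction φ t) := by
    filter_upwards [hb] with t ht using ht.const_mul (-Complex.I)
  refine ⟨hb, hφ.memLp_top_of_boundary hb, hφ.limsup_intervalMean_re hb,
    hφ.liminf_intervalMean_re hb, ?_, ?_⟩
  · simpa using hφ'.limsup_intervalMean_re hb'
  · simpa using hφ'.liminf_intervalMean_re hb'
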